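/- Let $H$ be a complex Hilbert space. For a compact operator $A$ on $H$ let $\mu_1(A)\ge\mu_2(A)\ge\dots$ be the eigenvalues of $|A|=(A^*A)^{1/2}$ in non-increasing order, counted with multiplicity (followed by zeros if $A$ has finite rank). A *singular trace* on $B(H)$ is a map $\tau:B(H)_+\to[0,\infty]$ that is additive and positively homogeneous, satisfies $\tau(B^*B)=\tau(BB^*)$ for all $B\in B(H)$, and vanishes on finite rank projections. A compact operator $A$ is *singularly traceable* if there is a singular trace $\tau$ with $0<\tau(|A|)<\infty$. If all $\mu_n(A)$ are positive, put $f_A(t)=-\log\mu_{\lfloor e^t\rfloor}(A)$ for $t\ge 0$ and, whenever the outer limits exist in $[0,\infty]$, $$\underline c(A)=\Big(\lim_{h\to\infty}\limsup_{t\to\infty}\frac{f_A(t+h)-f_A(t)}{h}\Big)^{-1},\qquad \overline c(A)=\Big(\lim_{h\to\infty}\liminf_{t\to\infty}\frac{f_A(t+h)-f_A(t)}{h}\Big)^{-1},$$ with $0^{-1}=\infty$ and $\infty^{-1}=0$. **Theorem 3.5.** Let $1=x_0\le x_1\le x_2\le\dots$ be integers with $x_n/x_{n+1}\to 0$, and let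 $\mu(y)=1/x_n$ for $x_{n-1}<y\le x_n$, $n\ge 1$. Let $T$ be a compact operator on $H$ such that $\mu_k(T)=\mu(k)$ for every integer $k\ge 2$. Then $|T|^\alpha$ (which is $T^\alpha$ when $T\ge 0$) is singularly traceable for every $\alpha>0$. Moreover the two outer limits defining $\underline c(T)$ and $\overline c(T)$ exist, and $\underline c(T)=0$, $\overline c(T)=\infty$. -/

import Mathlib

open Filter Topology
open scoped ENNReal NNReal

noncomputable section

namespace SingTrace

variable {H : Type*} [NormedAddCommGroup H] [InnerProductSpace ℂ H] [CompleteSpace H]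

/-- A tracial weight on `B(H)`: a `[0,∞]`-valued functional on the positive cone which is additive,
positively homogeneous (with `0 * ∞ = 0`) and satisfies `τ(A*A) = τ(AA*)`.
The values of `τ` outside the positive cone are irrelevant. -/
structure IsTracialWeight (τ : (H →L[ℂ] H) → ℝ≥0∞) : Prop where
  map_add : ∀ A B : H →L[ℂ] H, 0 ≤ A → 0 ≤ B → τ (A + B) = τ A + τ B
  map_smul : ∀ (c : ℝ≥0) (A : H →L[ℂ] H), 0 ≤ A → τ (((c : ℝ) : ℂ) • A) = (c : ℝ≥0∞) * τ A
  map_star_mul_self : ∀ A : H →L[ℂ] H, τ (star A * A) = τ (A * star A)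

/-- A singular trace on `B(H)`: a tracial weight vanishing on the finite rank projections. -/
structure IsSingularTrace (τ : (H →L[ℂ] H) → ℝ≥0∞) : Prop extends IsTracialWeight τ where
  map_finiteRank_projection : ∀ P : H →L[ℂ] H, IsStarProjection P →
    FiniteDimensional ℂ (LinearMap.range (P : H →ₗ[ℂ] H)) → τ P = 0

/-- A compact operator `A` is singularly traceable if some singular trace is finite and non-zero
on `|A|`. -/
def SingularlyTraceable (A : H →L[ℂ] H) : Prop :=
  IsCompactOperator A ∧
    ∃ τ : (H →L[ℂ] H) → ℝ≥0∞, IsSingularTrace τ ∧ τ (CFC.abs A) ≠ 0 ∧ τ (CFC.abs A) ≠ ∞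

/-- The span of the eigenspaces of `|A|` for the eigenvalues `l > s`. As eigenspaces are linearly
independent, its dimension is the number of eigenvalues of `|A|` greater than `s`, counted with
multiplicity. -/
def eigenspanAbove (A : H →L[ℂ] H) (s : ℝ) : Submodule ℂ H :=
  ⨆ (l : ℝ) (_ : s < l), Module.End.eigenspace ((CFC.abs A : H →L[ℂ] H) : H →ₗ[ℂ] H) (l : ℂ)

/-- The `n`-th eigenvalue `μ_n(A)` of `|A|` (`n = 1, 2, …`), for `A` compact, in the non-increasing
arrangement with multiplicity (followed by zeros if `A` has finite rank): the least `s ≥ 0` such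
that fewer than `n` eigenvalues of `|A|`, counted with multiplicity, are greater than `s`.
The index `0` is not used. -/
def mu (A : H →L[ℂ] H) (n : ℕ) : ℝ :=
  sInf {s : ℝ | 0 ≤ s ∧ Module.rank ℂ (eigenspanAbove A s) < (n : Cardinal)}

/-- `f_A(t) = -log μ_A(e^t)`, where `μ_A(y) = μ_n(A)` for `y ∈ [n, n+1)`. It is meant for compact
operators all of whose `μ_n` are positive, and only matters for large `t`. -/
def decayFn (A : H →L[ℂ] H) (t : ℝ) : ℝ :=
  -Real.log (mu A ⌊Real.exp t⌋₊)

/-- `c` is the lower index of `A`: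
`c = (lim_{h → ∞} limsup_{t → ∞} (f_A(t+h) - f_A(t)) / h)⁻¹`, where the outer limit exists in
`[0,∞]`, and `0⁻¹ = ∞`, `∞⁻¹ = 0`. -/
def HasLowerIndex (A : H →L[ℂ] H) (c : ℝ≥0∞) : Prop :=
  ∃ l : ℝ≥0∞,
    Tendsto (fun h : ℝ =>
      limsup (fun t : ℝ => (((decayFn A (t + h) - decayFn A t) / h : ℝ) : EReal)) atTop)
      atTop (𝓝 (l : EReal)) ∧ c = l⁻¹

/-- `c` is the upper index of `A`:
`c = (lim_{h → ∞} liminf_{t → ∞} (f_A(t+h) - f_A(t)) / h)⁻¹`, where the outer limit exists in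
`[0,∞]`, and `0⁻¹ = ∞`, `∞⁻¹ = 0`. -/
def HasUpperIndex (A : H →L[ℂ] H) (c : ℝ≥0∞) : Prop :=
  ∃ l : ℝ≥0∞,
    Tendsto (fun h : ℝ =>
      liminf (fun t : ℝ => (((decayFn A (t + h) - decayFn A t) / h : ℝ) : EReal)) atTop)
      atTop (𝓝 (l : EReal)) ∧ c = l⁻¹

end SingTrace

end

set_option linter.unusedSectionVars false

noncomputable section

namespace SingTrace

variable {H : Type*} [NormedAddCommGroup H] [InnerProductSpace ℂ H] [CompleteSpace H]

/-! ### Traces of compressions to finite-dimensional subspaces -/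

/-! On the block x_n < k ≤ x_{n+1} the eigenvalues of |T|^α equal κ_n = x_{n+1}^(-α), and lacunarity
makes their sum, about x_{n+1} κ_n, insensitive to bounded rescalings of the end points. Choose w_n
with w_n x_{n+1} κ_n = 1 and put φ_n(A) = w_n (K_A(p_n) - K_A(q_n)). Here K_A(N) is the Ky Fan
functional (for compact A ≥ 0, the sum of the N largest eigenvalues), and q_n, p_n are x_n, x_{n+1}
times slowly growing factors.

Ky Fan functionals are additive up to doubling the index: K_{A+B}(N) ≤ K_A(N) + K_B(N) ≤
K_{A+B}(2N). If A + B is O(κ_n) off O(x_n) dimensions, doubling q_n or p_n changes φ_n by o(1),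
since w_n q_n κ_n and w_n p_n κ_{n+1} tend to 0 (`tendsto_blockSum_add_sub`). So the limit of φ_n
along a free ultrafilter is additive on such operators; extended by ∞ it is a singular trace, finite
and nonzero on |T|^α (`trace_ne_top_of_dominates`, `trace_ne_zero_of_le_on_subspace`).

For the indices, f_T is a step function whose flat pieces and jumps both become arbitrarily long. A
window of fixed length h > 0 meets a huge jump for some large t and none for others, so the inner
limsup is ∞ and the inner liminf is 0 for every h > 0. -/

theorem sum_norm_inner_sq_le_of_mem_span {ι κ : Type*} [Fintype ι] [Fintype κ]
    {e : ι → H} {f : κ → H} (he : Orthonormal ℂ e) (hf : Orthonormal ℂ f)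
    (h : ∀ i, e i ∈ Submodule.span ℂ (Set.range f)) (y : H) :
    ∑ i, ‖inner ℂ (e i) y‖ ^ 2 ≤ ∑ j, ‖inner ℂ (f j) y‖ ^ 2 := by
  -- The projection of `y` onto the span of `f`; the `e i` cannot distinguish it from `y`, so
  -- Bessel's inequality for `y'` suffices.
  set y' : H := ∑ j, inner ℂ (f j) y • f j with hy'
  have hfy : ∀ j, inner ℂ (f j) y' = inner ℂ (f j) y := fun j => by
    rw [hy', hf.inner_right_fintype]
  have hspan : ∀ v ∈ Submodule.span ℂ (Set.range f), inner ℂ v y' = inner ℂ v y := by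
    intro v hv
    induction hv using Submodule.span_induction with
    | mem v hv => obtain ⟨j, rfl⟩ := hv; exact hfy j
    | zero => simp
    | add v w _ _ h1 h2 => rw [inner_add_left, inner_add_left, h1, h2]
    | smul c v _ h1 => rw [inner_smul_left, inner_smul_left, h1]
  have hnorm : ‖y'‖ ^ 2 = ∑ j, ‖inner ℂ (f j) y‖ ^ 2 := by
    have h1 : ((‖y'‖ ^ 2 : ℝ) : ℂ) = ((∑ j, ‖inner ℂ (f j) y‖ ^ 2 : ℝ) : ℂ) := by
      have h2 := inner_self_eq_norm_sq_to_K (𝕜 := ℂ) y'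
      push_cast
      refine (h2.symm.trans ?_ : ((‖y'‖ : ℝ) : ℂ) ^ 2 = _)
      conv_lhs => rw [hy']
      rw [sum_inner]
      refine Finset.sum_congr rfl fun j _ => ?_
      rw [inner_smul_left, hfy, mul_comm, Complex.mul_conj, Complex.normSq_eq_norm_sq]
      push_cast; rfl
    exact_mod_cast h1
  rw [← hnorm]
  calc ∑ i, ‖inner ℂ (e i) y‖ ^ 2 = ∑ i, ‖inner ℂ (e i) y'‖ ^ 2 :=
        Finset.sum_congr rfl fun i _ => by rw [hspan _ (h i)]
    _ ≤ ‖y'‖ ^ 2 := he.sum_inner_products_le y'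

theorem reApplyInnerSelf_add (A B : H →L[ℂ] H) (v : H) :
    (A + B).reApplyInnerSelf v = A.reApplyInnerSelf v + B.reApplyInnerSelf v := by
  simp [ContinuousLinearMap.reApplyInnerSelf_apply, inner_add_left]

theorem reApplyInnerSelf_ofReal_smul (c : ℝ) (A : H →L[ℂ] H) (v : H) :
    ((c : ℂ) • A).reApplyInnerSelf v = c * A.reApplyInnerSelf v := by
  simp only [ContinuousLinearMap.reApplyInnerSelf_apply, smul_apply,
    inner_smul_left, Complex.conj_ofReal]
  exact Complex.re_ofReal_mul _ _

theorem reApplyInnerSelf_star_mul_self (B : H →L[ℂ] H) (v : H) :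
    (star B * B).reApplyInnerSelf v = ‖B v‖ ^ 2 := by
  rw [ContinuousLinearMap.reApplyInnerSelf_apply, mul_apply_eq_comp,
    ContinuousLinearMap.star_eq_adjoint, ContinuousLinearMap.adjoint_inner_left,
    inner_self_eq_norm_sq]

theorem reApplyInnerSelf_mul_star_self (B : H →L[ℂ] H) (v : H) :
    (B * star B).reApplyInnerSelf v = ‖star B v‖ ^ 2 := by
  simpa using reApplyInnerSelf_star_mul_self (star B) v

theorem reApplyInnerSelf_nonneg {A : H →L[ℂ] H} (hA : 0 ≤ A) (v : H) :
    0 ≤ A.reApplyInnerSelf v :=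
  ((ContinuousLinearMap.nonneg_iff_isPositive A).1 hA).re_inner_nonneg_left v

theorem reApplyInnerSelf_le_norm_mul (A : H →L[ℂ] H) (v : H) :
    A.reApplyInnerSelf v ≤ ‖A‖ * ‖v‖ ^ 2 := by
  rw [ContinuousLinearMap.reApplyInnerSelf_apply]
  calc RCLike.re (inner ℂ (A v) v) ≤ ‖inner ℂ (A v) v‖ := RCLike.re_le_norm _
    _ ≤ ‖A v‖ * ‖v‖ := norm_inner_le_norm _ _
    _ ≤ ‖A‖ * ‖v‖ * ‖v‖ := by gcongr; exact A.le_opNorm v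
    _ = ‖A‖ * ‖v‖ ^ 2 := by ring

/-- Writing A = B*B and expanding ‖Bv‖² in an orthonormal basis g of the image of the span gives Σ_k
|⟨v, B*g_k⟩|². After exchanging sums, the vectors B*g_k are compared one at a time. -/
theorem sum_reApplyInnerSelf_le_of_mem_span {ι κ : Type*} [Fintype ι] [Fintype κ]
    {A : H →L[ℂ] H} (hA : 0 ≤ A) {e : ι → H} {f : κ → H} (he : Orthonormal ℂ e)
    (hf : Orthonormal ℂ f) (h : ∀ i, e i ∈ Submodule.span ℂ (Set.range f)) :
    ∑ i, A.reApplyInnerSelf (e i) ≤ ∑ j, A.reApplyInnerSelf (f j) := by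
  obtain ⟨B, rfl⟩ := CStarAlgebra.nonneg_iff_eq_star_mul_self.1 hA
  simp only [reApplyInnerSelf_star_mul_self]
  set G : Submodule ℂ H := (Submodule.span ℂ (Set.range f)).map (B : H →ₗ[ℂ] H) with hG
  have : FiniteDimensional ℂ (Submodule.span ℂ (Set.range f)) :=
    FiniteDimensional.span_of_finite ℂ (Set.finite_range f)
  let g := stdOrthonormalBasis ℂ G
  have key : ∀ v ∈ Submodule.span ℂ (Set.range f),
      ‖B v‖ ^ 2 = ∑ k, ‖inner ℂ v (star B (g k : H))‖ ^ 2 := by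
    intro v hv
    have hm : B v ∈ G := Submodule.mem_map_of_mem hv
    have := g.sum_sq_norm_inner_left ⟨B v, hm⟩
    rw [Submodule.coe_norm] at this
    simp only at this
    rw [← this]
    refine Finset.sum_congr rfl fun k _ => ?_
    rw [ContinuousLinearMap.star_eq_adjoint, ContinuousLinearMap.adjoint_inner_right]
    rfl
  rw [Finset.sum_congr rfl fun i _ => key (e i) (h i),
    Finset.sum_congr rfl fun j _ => key (f j) (Submodule.subset_span ⟨j, rfl⟩),
    Finset.sum_comm, Finset.sum_comm (γ := κ)]
  exact Finset.sum_le_sum fun k _ => sum_norm_inner_sq_le_of_mem_span he hf h _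

/-- The trace of the compression of `A` to a finite-dimensional subspace. -/
def compressionTrace (A : H →L[ℂ] H) (E : Submodule ℂ H) [FiniteDimensional ℂ E] : ℝ :=
  ∑ i, A.reApplyInnerSelf (stdOrthonormalBasis ℂ E i : H)

theorem orthonormal_stdOrthonormalBasis_coe (E : Submodule ℂ H) [FiniteDimensional ℂ E] :
    Orthonormal ℂ fun i => (stdOrthonormalBasis ℂ E i : H) :=
  (stdOrthonormalBasis ℂ E).orthonormal.comp_linearIsometry E.subtypeₗᵢ

theorem span_stdOrthonormalBasis_coe (E : Submodule ℂ H) [FiniteDimensional ℂ E] :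
    Submodule.span ℂ (Set.range fun i => (stdOrthonormalBasis ℂ E i : H)) = E := by
  have h := (stdOrthonormalBasis ℂ E).toBasis.span_eq
  have h2 : (Set.range fun i => (stdOrthonormalBasis ℂ E i : H)) =
      E.subtype '' Set.range (stdOrthonormalBasis ℂ E).toBasis := by
    rw [← Set.range_comp]; simp [Function.comp_def]
  rw [h2, Submodule.span_image, h, Submodule.map_subtype_top]

theorem sum_reApplyInnerSelf_le_compressionTrace {ι : Type*} [Fintype ι] {A : H →L[ℂ] H}
    (hA : 0 ≤ A) {e : ι → H} (he : Orthonormal ℂ e) {E : Submodule ℂ H} [FiniteDimensional ℂ E]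
    (h : ∀ i, e i ∈ E) : ∑ i, A.reApplyInnerSelf (e i) ≤ compressionTrace A E :=
  sum_reApplyInnerSelf_le_of_mem_span hA he (orthonormal_stdOrthonormalBasis_coe E)
    fun i => by rw [span_stdOrthonormalBasis_coe]; exact h i

theorem compressionTrace_le_sum_reApplyInnerSelf {ι : Type*} [Fintype ι] {A : H →L[ℂ] H}
    (hA : 0 ≤ A) {e : ι → H} (he : Orthonormal ℂ e) {E : Submodule ℂ H} [FiniteDimensional ℂ E]
    (h : E ≤ Submodule.span ℂ (Set.range e)) :
    compressionTrace A E ≤ ∑ i, A.reApplyInnerSelf (e i) :=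
  sum_reApplyInnerSelf_le_of_mem_span hA (orthonormal_stdOrthonormalBasis_coe E) he
    fun _ => h (Subtype.coe_prop _)

theorem compressionTrace_mono {A : H →L[ℂ] H} (hA : 0 ≤ A) {E F : Submodule ℂ H}
    [FiniteDimensional ℂ E] [FiniteDimensional ℂ F] (h : E ≤ F) :
    compressionTrace A E ≤ compressionTrace A F :=
  sum_reApplyInnerSelf_le_compressionTrace hA (orthonormal_stdOrthonormalBasis_coe E)
    fun _ => h (Subtype.coe_prop _)

theorem compressionTrace_sup {A : H →L[ℂ] H} (hA : 0 ≤ A) {E F : Submodule ℂ H}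
    [FiniteDimensional ℂ E] [FiniteDimensional ℂ F] (h : E ⟂ F) :
    compressionTrace A (E ⊔ F) = compressionTrace A E + compressionTrace A F := by
  have he : Orthonormal ℂ (Sum.elim (fun i => (stdOrthonormalBasis ℂ E i : H))
      fun i => (stdOrthonormalBasis ℂ F i : H)) := by
    refine ⟨?_, ?_⟩
    · rintro (i | i)
      · exact (orthonormal_stdOrthonormalBasis_coe E).1 i
      · exact (orthonormal_stdOrthonormalBasis_coe F).1 i
    · rintro (i | i) (j | j) hij
      · exact (orthonormal_stdOrthonormalBasis_coe E).2 fun h => hij (by rw [h])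
      · exact h.inner_eq (Subtype.coe_prop _) (Subtype.coe_prop _)
      · exact h.symm.inner_eq (Subtype.coe_prop _) (Subtype.coe_prop _)
      · exact (orthonormal_stdOrthonormalBasis_coe F).2 fun h => hij (by rw [h])
  have hsum : ∑ i, A.reApplyInnerSelf (Sum.elim (fun i => (stdOrthonormalBasis ℂ E i : H))
      (fun i => (stdOrthonormalBasis ℂ F i : H)) i) =
      compressionTrace A E + compressionTrace A F := by
    rw [Fintype.sum_sum_type]; rfl
  rw [← hsum]
  refine le_antisymm (compressionTrace_le_sum_reApplyInnerSelf hA he ?_)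
    (sum_reApplyInnerSelf_le_compressionTrace hA he ?_)
  · rw [Set.Sum.elim_range, Submodule.span_union, span_stdOrthonormalBasis_coe,
      span_stdOrthonormalBasis_coe]
  · rintro (i | i)
    · exact Submodule.mem_sup_left (Subtype.coe_prop _)
    · exact Submodule.mem_sup_right (Subtype.coe_prop _)

theorem compressionTrace_add (A B : H →L[ℂ] H) (E : Submodule ℂ H) [FiniteDimensional ℂ E] :
    compressionTrace (A + B) E = compressionTrace A E + compressionTrace B E := by
  simp only [compressionTrace, reApplyInnerSelf_add, Finset.sum_add_distrib]

theorem compressionTrace_ofReal_smul (c : ℝ) (A : H →L[ℂ] H) (E : Submodule ℂ H)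
    [FiniteDimensional ℂ E] : compressionTrace ((c : ℂ) • A) E = c * compressionTrace A E := by
  simp only [compressionTrace, reApplyInnerSelf_ofReal_smul, Finset.mul_sum]

theorem compressionTrace_le_finrank_mul {A : H →L[ℂ] H} {E : Submodule ℂ H}
    [FiniteDimensional ℂ E] {c : ℝ} (h : ∀ v ∈ E, A.reApplyInnerSelf v ≤ c * ‖v‖ ^ 2) :
    compressionTrace A E ≤ Module.finrank ℂ E * c := by
  have : ∀ i, A.reApplyInnerSelf (stdOrthonormalBasis ℂ E i : H) ≤ c := fun i => by
    simpa [(orthonormal_stdOrthonormalBasis_coe E).1 i] using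
      h (stdOrthonormalBasis ℂ E i) (Subtype.coe_prop _)
  simpa [compressionTrace] using Finset.sum_le_sum fun i (_ : i ∈ Finset.univ) => this i

theorem finrank_mul_le_compressionTrace {A : H →L[ℂ] H} {E : Submodule ℂ H}
    [FiniteDimensional ℂ E] {c : ℝ} (h : ∀ v ∈ E, c * ‖v‖ ^ 2 ≤ A.reApplyInnerSelf v) :
    Module.finrank ℂ E * c ≤ compressionTrace A E := by
  have : ∀ i, c ≤ A.reApplyInnerSelf (stdOrthonormalBasis ℂ E i : H) := fun i => by
    simpa [(orthonormal_stdOrthonormalBasis_coe E).1 i] using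
      h (stdOrthonormalBasis ℂ E i) (Subtype.coe_prop _)
  simpa [compressionTrace] using Finset.sum_le_sum fun i (_ : i ∈ Finset.univ) => this i

/-! ### Ky Fan functionals -/

/-- The Ky Fan functional: the supremum of the traces of the compressions of `A` to subspaces of
dimension at most `N`. -/
def kyFan (A : H →L[ℂ] H) (N : ℕ) : ℝ :=
  sSup {r | ∃ (E : Submodule ℂ H) (_ : FiniteDimensional ℂ E),
    Module.finrank ℂ E ≤ N ∧ compressionTrace A E = r}

theorem compressionTrace_le_kyFan (A : H →L[ℂ] H) {N : ℕ} (E : Submodule ℂ H)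
    [FiniteDimensional ℂ E] (hE : Module.finrank ℂ E ≤ N) :
    compressionTrace A E ≤ kyFan A N := by
  refine le_csSup ⟨N * ‖A‖, ?_⟩ ⟨E, inferInstance, hE, rfl⟩
  rintro _ ⟨F, hF, hN, rfl⟩
  refine (compressionTrace_le_finrank_mul fun v _ => reApplyInnerSelf_le_norm_mul A v).trans ?_
  gcongr

theorem kyFan_le {A : H →L[ℂ] H} {N : ℕ} {c : ℝ}
    (h : ∀ (E : Submodule ℂ H) [FiniteDimensional ℂ E], Module.finrank ℂ E ≤ N →
      compressionTrace A E ≤ c) : kyFan A N ≤ c := by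
  refine csSup_le ⟨_, ⊥, inferInstance, by simp, rfl⟩ ?_
  rintro _ ⟨E, hE, hN, rfl⟩
  exact h E hN

theorem kyFan_mono (A : H →L[ℂ] H) : Monotone (kyFan A) := fun _ _ h =>
  kyFan_le fun E _ hE => compressionTrace_le_kyFan A E (hE.trans h)

theorem kyFan_add_le (A B : H →L[ℂ] H) (N : ℕ) : kyFan (A + B) N ≤ kyFan A N + kyFan B N :=
  kyFan_le fun E _ hE => by
    rw [compressionTrace_add]
    exact add_le_add (compressionTrace_le_kyFan A E hE) (compressionTrace_le_kyFan B E hE)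

/-- Near-optimal subspaces for A and B both lie in their sum, of dimension at most N + M. With
`kyFan_add_le` this replaces additivity. -/
theorem kyFan_add_kyFan_le {A B : H →L[ℂ] H} (hA : 0 ≤ A) (hB : 0 ≤ B) (N M : ℕ) :
    kyFan A N + kyFan B M ≤ kyFan (A + B) (N + M) := by
  rw [← le_sub_iff_add_le]
  refine kyFan_le fun E _ hE => ?_
  rw [le_sub_comm]
  refine kyFan_le fun F _ hF => ?_
  rw [le_sub_iff_add_le]
  have h1 := compressionTrace_mono hA (le_sup_left : E ≤ E ⊔ F)
  have h2 := compressionTrace_mono hB (le_sup_right : F ≤ E ⊔ F)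
  have h3 := compressionTrace_le_kyFan (A + B) (E ⊔ F)
    ((Submodule.finrank_add_le_finrank_add_finrank E F).trans (add_le_add hE hF))
  rw [compressionTrace_add] at h3
  linarith

theorem kyFan_ofReal_smul {c : ℝ} (hc : 0 < c) (A : H →L[ℂ] H) (N : ℕ) :
    kyFan ((c : ℂ) • A) N = c * kyFan A N := by
  refine le_antisymm (kyFan_le fun E _ hE => ?_) ?_
  · rw [compressionTrace_ofReal_smul]
    exact mul_le_mul_of_nonneg_left (compressionTrace_le_kyFan A E hE) hc.le
  · rw [← le_div_iff₀' hc]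
    refine kyFan_le fun E _ hE => ?_
    rw [le_div_iff₀' hc, ← compressionTrace_ofReal_smul]
    exact compressionTrace_le_kyFan _ E hE

/-- The trace of B*B on E is at most that of BB* on B(E): expand both as double sums and apply
Bessel's inequality in E. -/
theorem kyFan_star_mul_self_le (B : H →L[ℂ] H) (N : ℕ) :
    kyFan (star B * B) N ≤ kyFan (B * star B) N := by
  refine kyFan_le fun E _ hE => ?_
  set F : Submodule ℂ H := E.map (B : H →ₗ[ℂ] H) with hF
  refine le_trans ?_ (compressionTrace_le_kyFan _ F ((Submodule.finrank_map_le _ _).trans hE))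
  simp only [compressionTrace, reApplyInnerSelf_star_mul_self, reApplyInnerSelf_mul_star_self]
  have key : ∀ v ∈ E,
      ‖B v‖ ^ 2 = ∑ k, ‖inner ℂ v (star B (stdOrthonormalBasis ℂ F k : H))‖ ^ 2 := by
    intro v hv
    have hm : B v ∈ F := Submodule.mem_map_of_mem hv
    have := (stdOrthonormalBasis ℂ F).sum_sq_norm_inner_left ⟨B v, hm⟩
    rw [Submodule.coe_norm] at this
    simp only at this
    rw [← this]
    refine Finset.sum_congr rfl fun k _ => ?_
    rw [ContinuousLinearMap.star_eq_adjoint, ContinuousLinearMap.adjoint_inner_right]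
    rfl
  rw [Finset.sum_congr rfl fun i _ => key _ (Subtype.coe_prop (stdOrthonormalBasis ℂ E i)),
    Finset.sum_comm]
  exact Finset.sum_le_sum fun k _ =>
    (orthonormal_stdOrthonormalBasis_coe E).sum_inner_products_le _

theorem kyFan_star_mul_self (B : H →L[ℂ] H) (N : ℕ) :
    kyFan (star B * B) N = kyFan (B * star B) N :=
  le_antisymm (kyFan_star_mul_self_le B N) (by simpa using kyFan_star_mul_self_le (star B) N)

/-- A test space E splits into E ∩ Vᗮ, where each dimension costs at most c, and the orthogonal
complement of that in E, which projects injectively to V. -/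
theorem kyFan_le_add_of_le_on_orthogonal {A : H →L[ℂ] H} (hA : 0 ≤ A) {V : Submodule ℂ H}
    [FiniteDimensional ℂ V] {d : ℕ} (hd : Module.finrank ℂ V ≤ d) {c : ℝ} (hc : 0 ≤ c)
    (h : ∀ v ∈ Vᗮ, A.reApplyInnerSelf v ≤ c * ‖v‖ ^ 2) (N : ℕ) :
    kyFan A N ≤ kyFan A d + N * c := by
  refine kyFan_le fun E _ hE => ?_
  let E₁ : Submodule ℂ H := E ⊓ Vᗮ
  let E₂ : Submodule ℂ H := E₁ᗮ ⊓ E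
  have hE₁ : E₁ ≤ E := inf_le_left
  have : FiniteDimensional ℂ E₁ := Submodule.finiteDimensional_of_le hE₁
  have : FiniteDimensional ℂ E₂ := Submodule.finiteDimensional_of_le (inf_le_right : E₂ ≤ E)
  have hsup : E₁ ⊔ E₂ = E := Submodule.sup_orthogonal_inf_of_hasOrthogonalProjection hE₁
  have hort : E₁ ⟂ E₂ := (Submodule.isOrtho_orthogonal_right E₁).mono_right inf_le_left
  have h1 : compressionTrace A E ≤ compressionTrace A E₁ + compressionTrace A E₂ := by
    rw [← compressionTrace_sup hA hort]
    exact compressionTrace_mono hA hsup.ge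
  have h2 : Module.finrank ℂ E₂ ≤ d := by
    refine le_trans ?_ hd
    let φ : E₂ →ₗ[ℂ] V := (V.orthogonalProjectionOnto : H →ₗ[ℂ] V) ∘ₗ E₂.subtype
    refine LinearMap.finrank_le_finrank_of_injective (f := φ) ?_
    rw [← LinearMap.ker_eq_bot, LinearMap.ker_eq_bot']
    rintro ⟨v, hv1, hv2⟩ hv
    have hv' : v ∈ Vᗮ := Submodule.orthogonalProjectionOnto_eq_zero_iff.1 hv
    have : inner ℂ v v = 0 := hv1 v ⟨hv2, hv'⟩
    exact Subtype.ext (inner_self_eq_zero.1 this)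
  have h3 := compressionTrace_le_kyFan A E₂ h2
  have h4 : compressionTrace A E₁ ≤ N * c := by
    refine (compressionTrace_le_finrank_mul fun v (hv : v ∈ E ⊓ Vᗮ) => h v hv.2).trans ?_
    gcongr
    exact (Submodule.finrank_mono hE₁).trans hE
  linarith

theorem exists_submodule_le_finrank_eq {W : Submodule ℂ H} {N : ℕ}
    (hN : (N : Cardinal) ≤ Module.rank ℂ W) :
    ∃ W' ≤ W, FiniteDimensional ℂ W' ∧ Module.finrank ℂ W' = N := by
  obtain ⟨s, hs, hli⟩ := le_rank_iff_exists_linearIndependent_finset.1 hN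
  have := FiniteDimensional.span_finset ℂ s
  refine ⟨(Submodule.span ℂ (s : Set W)).map W.subtype, Submodule.map_subtype_le _ _,
    inferInstance, ?_⟩
  rw [LinearEquiv.finrank_eq (Submodule.equivMapOfInjective W.subtype W.injective_subtype _).symm,
    finrank_span_finset_eq_card hli, hs]

/-- An N-dimensional part of W meets Eᗮ in dimension at least N - dim E. Adjoining these directions
to E gains at least c for each. -/
theorem kyFan_add_le_of_le_on_subspace {A : H →L[ℂ] H} (hA : 0 ≤ A) {W : Submodule ℂ H}
    {N q : ℕ} (hq : q ≤ N) (hN : (N : Cardinal) ≤ Module.rank ℂ W) {c : ℝ} (hc : 0 ≤ c)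
    (h : ∀ v ∈ W, c * ‖v‖ ^ 2 ≤ A.reApplyInnerSelf v) :
    kyFan A q + ((N : ℝ) - q) * c ≤ kyFan A N := by
  obtain ⟨W', hW', hfin, hrank⟩ := exists_submodule_le_finrank_eq hN
  rw [← le_sub_iff_add_le]
  refine kyFan_le fun E _ hE => ?_
  let G : Submodule ℂ H := W' ⊓ Eᗮ
  have : FiniteDimensional ℂ G := Submodule.finiteDimensional_of_le (inf_le_left : G ≤ W')
  have hG : N ≤ Module.finrank ℂ G + Module.finrank ℂ E := by
    let φ : W' →ₗ[ℂ] E := (E.orthogonalProjectionOnto : H →ₗ[ℂ] E) ∘ₗ W'.subtype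
    have h1 := φ.finrank_range_add_finrank_ker
    have h2 : Module.finrank ℂ (LinearMap.range φ) ≤ Module.finrank ℂ E :=
      Submodule.finrank_le _
    have h3 : Module.finrank ℂ (LinearMap.ker φ) ≤ Module.finrank ℂ G := by
      have hmem : ∀ w : LinearMap.ker φ, ((w : W') : H) ∈ G := fun w =>
        ⟨Subtype.coe_prop _, Submodule.orthogonalProjectionOnto_eq_zero_iff.1 w.2⟩
      refine LinearMap.finrank_le_finrank_of_injective
        (f := (W'.subtype ∘ₗ (LinearMap.ker φ).subtype).codRestrict G hmem) fun a b hab => ?_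
      exact Subtype.ext (Subtype.ext (congrArg (fun z : G => (z : H)) hab))
    omega
  obtain ⟨G', hG', _, hG'r⟩ := exists_submodule_le_finrank_eq (W := G)
    (N := N - Module.finrank ℂ E) (by rw [← Module.finrank_eq_rank]; exact_mod_cast (by omega))
  have hort : E ⟂ G' :=
    (Submodule.isOrtho_orthogonal_right E).mono_right (hG'.trans inf_le_right)
  have h1 := compressionTrace_sup hA hort
  have h2 := compressionTrace_le_kyFan A (N := N) (E ⊔ G')
    ((Submodule.finrank_add_le_finrank_add_finrank E G').trans (by omega))
  have h3 := finrank_mul_le_compressionTrace (A := A) (E := G')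
    fun v hv => h v (hW' (hG' hv).1)
  have h4 : ((N : ℝ) - q) * c ≤ Module.finrank ℂ G' * c := by
    refine mul_le_mul_of_nonneg_right ?_ hc
    rw [hG'r, Nat.cast_sub (hE.trans hq)]
    have : (Module.finrank ℂ E : ℝ) ≤ q := by exact_mod_cast hE
    linarith
  linarith

/-! ### Functional calculus of compact operators -/

theorem mem_spectrum_of_apply_eq_smul {P : H →L[ℂ] H} {l : ℝ} {v : H} (hv : v ≠ 0)
    (h : P v = (l : ℂ) • v) : l ∈ spectrum ℝ P := by
  rw [spectrum.mem_iff]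
  rintro ⟨u, hu⟩
  have h0 : (u : H →L[ℂ] H) v = 0 := by
    rw [hu, sub_apply, h, sub_eq_zero]
    simp [Algebra.algebraMap_eq_smul_one]
  apply hv
  have h1 : ((↑u⁻¹ : H →L[ℂ] H) * (u : H →L[ℂ] H)) v = v := by simp
  rw [← h1, mul_apply_eq_comp, h0, map_zero]

/-- The functions satisfying the identity form a closed subalgebra containing the constants and the
identity, so Stone–Weierstrass applies. -/
theorem cfc_apply_of_apply_eq_smul {P : H →L[ℂ] H} (hP : IsSelfAdjoint P) {f : ℝ → ℝ}
    (hf : ContinuousOn f (spectrum ℝ P)) {l : ℝ} {v : H} (h : P v = (l : ℂ) • v) :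
    cfc f P v = (f l : ℂ) • v := by
  rcases eq_or_ne v 0 with rfl | hv
  · simp
  let l' : spectrum ℝ P := ⟨l, mem_spectrum_of_apply_eq_smul hv h⟩
  suffices hg : ∀ g : C(spectrum ℝ P, ℝ), cfcHom hP g v = (g l' : ℂ) • v by
    rw [cfc_apply f P]
    exact hg _
  intro g
  induction g using ContinuousMap.induction_on_of_compact with
  | const r =>
    have : ContinuousMap.const (spectrum ℝ P) r = algebraMap ℝ _ r := rfl
    rw [this, AlgHomClass.commutes]
    simp [Algebra.algebraMap_eq_smul_one]
  | id => rw [cfcHom_id]; exact h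
  | star_id => rw [star_trivial, cfcHom_id]; exact h
  | add f g hf hg => simp [hf, hg, add_smul]
  | mul f g hf hg =>
    rw [map_mul, mul_apply_eq_comp, hg, map_smul, hf, smul_smul, ContinuousMap.mul_apply,
      Complex.ofReal_mul, mul_comm]
  | frequently f hf =>
    have hcl : IsClosed {g : C(spectrum ℝ P, ℝ) | cfcHom hP g v = (g l' : ℂ) • v} := by
      refine isClosed_eq ?_ ?_
      · exact (ContinuousLinearMap.apply ℂ H v).continuous.comp (cfcHom_continuous hP)
      · exact (Complex.continuous_ofReal.comp (continuous_eval_const l')).smul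
          continuous_const
    exact hcl.closure_subset (mem_closure_iff_frequently.2 hf)

/-- The compact operators form a closed ideal. The non-unital calculus is essential, as constants
would give non-compact scalars; continuity of `f` is not needed, the default value 0 being compact.
-/
theorem isCompactOperator_cfcₙ {P : H →L[ℂ] H} (hP : IsSelfAdjoint P) (hPc : IsCompactOperator P)
    (f : ℝ → ℝ) : IsCompactOperator (cfcₙ f P : H →L[ℂ] H) := by
  refine cfcₙ_cases (fun B : H →L[ℂ] H => IsCompactOperator B) P f isCompactOperator_zero
    fun hf hf0 ha => ?_
  generalize (⟨⟨_, hf.domRestrict⟩, hf0⟩ : ContinuousMapZero (quasispectrum ℝ P) ℝ) = g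
  induction g using ContinuousMapZero.induction_on_of_compact with
  | zero => rw [map_zero]; exact isCompactOperator_zero
  | id => rw [cfcₙHom_id]; exact hPc
  | star_id => rw [map_star, cfcₙHom_id, hP.star_eq]; exact hPc
  | add f g hf hg => rw [map_add]; exact hf.add hg
  | mul f g hf hg => rw [map_mul]; exact hf.comp_clm _
  | smul r f hf =>
    rw [map_smul]; exact hf.smul r
  | frequently f hf =>
    have hcl : IsClosed {g : ContinuousMapZero (quasispectrum ℝ P) ℝ |
        IsCompactOperator (cfcₙHom ha g)} :=
      (isClosed_setOfPred_isCompactOperator (σ₁₂ := RingHom.id ℂ) (M₁ := H) (M₂ := H)).preimage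
        (cfcₙHom_continuous ha)
    exact hcl.closure_subset (mem_closure_iff_frequently.2 hf)

theorem isCompactOperator_abs {T : H →L[ℂ] H} (hT : IsCompactOperator T) :
    IsCompactOperator (CFC.abs T : H →L[ℂ] H) := by
  rw [CFC.abs, CFC.sqrt_eq_real_sqrt (star T * T)]
  exact isCompactOperator_cfcₙ (IsSelfAdjoint.star_mul_self T) (hT.clm_comp (star T)) _

theorem continuousOn_rpow_spectrum {α : ℝ} (hα : 0 < α) (P : H →L[ℂ] H) :
    ContinuousOn (fun t : ℝ => t ^ α) (spectrum ℝ P) :=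
  (Real.continuous_rpow_const hα.le).continuousOn

theorem isCompactOperator_rpow {P : H →L[ℂ] H} (hP : 0 ≤ P) (hPc : IsCompactOperator P) {α : ℝ}
    (hα : 0 < α) : IsCompactOperator (P ^ α : H →L[ℂ] H) := by
  rw [CFC.rpow_eq_cfc_real hP, ← cfcₙ_eq_cfc (hf := (Real.continuous_rpow_const hα.le).continuousOn)
    (hf0 := Real.zero_rpow hα.ne')]
  exact isCompactOperator_cfcₙ (IsSelfAdjoint.of_nonneg hP) hPc _

theorem rpow_apply_of_apply_eq_smul {P : H →L[ℂ] H} (hP : 0 ≤ P) {α : ℝ} (hα : 0 < α) {l : ℝ}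
    {v : H} (h : P v = (l : ℂ) • v) : (P ^ α) v = ((l ^ α : ℝ) : ℂ) • v := by
  rw [CFC.rpow_eq_cfc_real hP]
  exact cfc_apply_of_apply_eq_smul (IsSelfAdjoint.of_nonneg hP) (continuousOn_rpow_spectrum hα P) h

theorem eq_zero_or_nonneg_of_apply_eq_smul {P : H →L[ℂ] H} (hP : 0 ≤ P) {l : ℝ} {v : H}
    (h : P v = (l : ℂ) • v) : v = 0 ∨ 0 ≤ l := by
  rcases eq_or_ne v 0 with hv | hv
  · exact .inl hv
  right
  have h1 := reApplyInnerSelf_nonneg hP v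
  rw [ContinuousLinearMap.reApplyInnerSelf_apply, h, inner_smul_left, Complex.conj_ofReal,
    inner_self_eq_norm_sq_to_K] at h1
  have h2 : (0 : ℝ) ≤ l * ‖v‖ ^ 2 := by
    refine h1.trans_eq ?_
    have : ((l : ℂ) * ((‖v‖ : ℝ) : ℂ) ^ 2) = ((l * ‖v‖ ^ 2 : ℝ) : ℂ) := by push_cast; rfl
    exact (congrArg Complex.re this).trans (Complex.ofReal_re _)
  exact nonneg_of_mul_nonneg_left h2 (by positivity)

/-- Eigenspaces are mutually orthogonal, so the form of A is diagonal on their span. The alternative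
`w = 0` excuses those l in S that are not eigenvalues. -/
theorem le_reApplyInnerSelf_of_mem_iSup_eigenspace {P A : H →L[ℂ] H} (hP : IsSelfAdjoint P)
    {S : Set ℝ} {g : ℝ → ℝ} {c : ℝ}
    (hA : ∀ l ∈ S, ∀ w : H, P w = (l : ℂ) • w → A w = (g l : ℂ) • w)
    (hc : ∀ l ∈ S, ∀ w : H, P w = (l : ℂ) • w → w = 0 ∨ c ≤ g l) {v : H}
    (hv : v ∈ ⨆ l ∈ S, Module.End.eigenspace (P : H →ₗ[ℂ] H) (l : ℂ)) :
    c * ‖v‖ ^ 2 ≤ A.reApplyInnerSelf v := by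
  have hfam : OrthogonalFamily ℂ (fun l : S => Module.End.eigenspace (P : H →ₗ[ℂ] H) ((l : ℝ) : ℂ))
      fun l => (Module.End.eigenspace (P : H →ₗ[ℂ] H) ((l : ℝ) : ℂ)).subtypeₗᵢ :=
    hP.isSymmetric.orthogonalFamily_eigenspaces.comp (γ := S) (f := fun l => ((l : ℝ) : ℂ))
      fun a b hab => Subtype.ext (Complex.ofReal_injective hab)
  rw [iSup_subtype', Submodule.mem_iSup_iff_exists_finsupp] at hv
  obtain ⟨f, hf, rfl⟩ := hv
  have hf' : ∀ l : S, P (f l) = ((l : ℝ) : ℂ) • f l := fun l =>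
    Module.End.mem_eigenspace_iff.1 (hf l)
  let f₁ : ∀ l : S, Module.End.eigenspace (P : H →ₗ[ℂ] H) ((l : ℝ) : ℂ) := fun l => ⟨f l, hf l⟩
  have hn := hfam.norm_sum f₁ f.support
  have hi := hfam.inner_sum (fun l => (g l : ℂ) • f₁ l) f₁ f.support
  simp only [Finsupp.sum]
  have hAv : A (∑ l ∈ f.support, f l) = ∑ l ∈ f.support, (g l : ℂ) • f l := by
    rw [map_sum]
    exact Finset.sum_congr rfl fun l _ => hA l l.2 _ (hf' l)
  have hform : A.reApplyInnerSelf (∑ l ∈ f.support, f l) =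
      ∑ l ∈ f.support, g l * ‖f l‖ ^ 2 := by
    rw [ContinuousLinearMap.reApplyInnerSelf_apply, hAv]
    refine (congrArg RCLike.re hi).trans ?_
    rw [map_sum]
    refine Finset.sum_congr rfl fun l _ => ?_
    rw [inner_smul_left, Complex.conj_ofReal, inner_self_eq_norm_sq_to_K]
    have : ((g l : ℂ) * ((‖f l‖ : ℝ) : ℂ) ^ 2) = ((g l * ‖f l‖ ^ 2 : ℝ) : ℂ) := by push_cast; rfl
    exact (congrArg Complex.re this).trans (Complex.ofReal_re _)
  have hnorm : ‖∑ l ∈ f.support, f l‖ ^ 2 = ∑ l ∈ f.support, ‖f l‖ ^ 2 := hn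
  rw [hform, hnorm, Finset.mul_sum]
  refine Finset.sum_le_sum fun l _ => ?_
  rcases hc l l.2 _ (hf' l) with h | h
  · simp [h]
  · gcongr

theorem rpow_mul_norm_sq_le_of_mem_eigenspanAbove (T : H →L[ℂ] H) {α : ℝ} (hα : 0 < α) {s : ℝ}
    (hs : 0 ≤ s) {v : H} (hv : v ∈ eigenspanAbove T s) :
    s ^ α * ‖v‖ ^ 2 ≤ (CFC.abs T ^ α).reApplyInnerSelf v := by
  have hP : 0 ≤ CFC.abs T := CFC.abs_nonneg T
  exact le_reApplyInnerSelf_of_mem_iSup_eigenspace (S := Set.Ioi s) (g := fun l => l ^ α)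
    (IsSelfAdjoint.of_nonneg hP) (fun l _ w hw => rpow_apply_of_apply_eq_smul hP hα hw)
    (fun l hl w _ => .inr (Real.rpow_le_rpow hs (Set.mem_Ioi.1 hl).le hα.le)) hv

theorem le_rpow_mul_norm_sq_of_mem_orthogonal_eigenspanAbove {T : H →L[ℂ] H}
    (hT : IsCompactOperator T) {α : ℝ} (hα : 0 < α) {s : ℝ} {v : H}
    (hv : v ∈ (eigenspanAbove T s)ᗮ) :
    (CFC.abs T ^ α).reApplyInnerSelf v ≤ s ^ α * ‖v‖ ^ 2 := by
  have hP : 0 ≤ CFC.abs T := CFC.abs_nonneg T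
  have hPs : IsSelfAdjoint (CFC.abs T) := IsSelfAdjoint.of_nonneg hP
  set U : Submodule ℂ H := ⨆ l ∈ Set.Iic s,
    Module.End.eigenspace ((CFC.abs T : H →L[ℂ] H) : H →ₗ[ℂ] H) (l : ℂ) with hU
  have hbound : ∀ u ∈ U, (CFC.abs T ^ α).reApplyInnerSelf u ≤ s ^ α * ‖u‖ ^ 2 := by
    intro u hu
    -- The lower bound for the negated operator is the desired upper bound.
    have h1 := le_reApplyInnerSelf_of_mem_iSup_eigenspace (A := ((-1 : ℝ) : ℂ) • CFC.abs T ^ α)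
      (g := fun l => -l ^ α) (c := -s ^ α) hPs ?_ ?_ hu
    · rw [reApplyInnerSelf_ofReal_smul] at h1
      linarith
    · intro l _ w hw
      rw [smul_apply, rpow_apply_of_apply_eq_smul hP hα hw, smul_smul]
      push_cast; simp
    · intro l hl w hw
      rcases eq_zero_or_nonneg_of_apply_eq_smul hP hw with h | h
      · exact .inl h
      · exact .inr (neg_le_neg (Real.rpow_le_rpow h hl hα.le))
  have hUV : U ≤ (eigenspanAbove T s)ᗮ := by
    have : U ⟂ eigenspanAbove T s := by
      simp only [hU, eigenspanAbove, Submodule.isOrtho_iSup_left, Submodule.isOrtho_iSup_right]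
      intro m hm l hl
      refine (hPs.isSymmetric.orthogonalFamily_eigenspaces.isOrtho ?_)
      intro h
      have := Complex.ofReal_injective h
      have hl' : l ≤ s := hl
      linarith
    exact this.le
  -- Compactness enters here: the eigenspaces of |T| span a dense subspace, and all eigenvalues are
  -- real.
  have htop : (U ⊔ eigenspanAbove T s)ᗮ = ⊥ := by
    rw [eq_bot_iff, ← ContinuousLinearMap.orthogonalComplement_iSup_eigenspaces_eq_bot
      (isCompactOperator_abs hT) hPs.isSymmetric]
    refine Submodule.orthogonal_le (iSup_le fun μ => ?_)
    by_cases hμ : Module.End.HasEigenvalue ((CFC.abs T : H →L[ℂ] H) : H →ₗ[ℂ] H) μ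
    · have hre : ((μ.re : ℝ) : ℂ) = μ :=
        Complex.conj_eq_iff_re.1 (hPs.isSymmetric.conj_eigenvalue_eq_self hμ)
      rw [← hre]
      rcases le_or_gt μ.re s with h | h
      · exact (le_iSup₂_of_le (f := fun l (_ : l ∈ Set.Iic s) => Module.End.eigenspace
          ((CFC.abs T : H →L[ℂ] H) : H →ₗ[ℂ] H) (l : ℂ)) μ.re h le_rfl).trans le_sup_left
      · exact (le_iSup₂_of_le (f := fun l (_ : s < l) => Module.End.eigenspace
          ((CFC.abs T : H →L[ℂ] H) : H →ₗ[ℂ] H) (l : ℂ)) μ.re h le_rfl).trans le_sup_right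
    · rw [Module.End.hasEigenvalue_iff, not_not] at hμ
      exact hμ.le.trans bot_le
  -- Splitting the complement of the upper eigenspaces along the closure of `U` leaves a remainder
  -- that `htop` kills.
  have hmem : v ∈ U.topologicalClosure := by
    rw [← Submodule.orthogonal_orthogonal_eq_closure]
    have : (Uᗮᗮ ⊔ (Uᗮᗮᗮ ⊓ (eigenspanAbove T s)ᗮ)) = (eigenspanAbove T s)ᗮ := by
      refine Submodule.sup_orthogonal_inf_of_hasOrthogonalProjection ?_
      rw [Submodule.orthogonal_orthogonal_eq_closure]
      exact Submodule.topologicalClosure_minimal _ hUV (Submodule.isClosed_orthogonal _)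
    rw [Submodule.triorthogonal_eq_orthogonal, Submodule.inf_orthogonal, htop, sup_bot_eq] at this
    rwa [this]
  have hcl : IsClosed {u : H | (CFC.abs T ^ α).reApplyInnerSelf u ≤ s ^ α * ‖u‖ ^ 2} :=
    isClosed_le (ContinuousLinearMap.reApplyInnerSelf_continuous _) (by fun_prop)
  exact closure_minimal hbound hcl hmem

/-! ### Limits along a free ultrafilter -/

/-- The limit in `[0,∞]`, along a fixed free ultrafilter, of the positive part of a real sequence. -/
def ultraLim (u : ℕ → ℝ) : ℝ≥0∞ :=
  ((hyperfilter ℕ).map fun n => ENNReal.ofReal (u n)).lim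

theorem tendsto_ultraLim (u : ℕ → ℝ) :
    Tendsto (fun n => ENNReal.ofReal (u n)) (hyperfilter ℕ) (𝓝 (ultraLim u)) :=
  Ultrafilter.le_nhds_lim ((hyperfilter ℕ).map fun n => ENNReal.ofReal (u n))

theorem hyperfilter_le_atTop : (hyperfilter ℕ : Filter ℕ) ≤ atTop := by
  rw [← Nat.cofinite_eq_atTop]; exact hyperfilter_le_cofinite

theorem ultraLim_le_of_tendsto_sub {u v : ℕ → ℝ}
    (h : Tendsto (fun n => u n - v n) atTop (𝓝 0)) : ultraLim u ≤ ultraLim v := by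
  have h1 : Tendsto (fun n => ENNReal.ofReal (v n) + ENNReal.ofReal (u n - v n))
      (hyperfilter ℕ) (𝓝 (ultraLim v + ENNReal.ofReal 0)) :=
    (tendsto_ultraLim v).add (ENNReal.tendsto_ofReal (h.mono_left hyperfilter_le_atTop))
  rw [ENNReal.ofReal_zero, add_zero] at h1
  refine le_of_tendsto_of_tendsto' (tendsto_ultraLim u) h1 fun n => ?_
  calc ENNReal.ofReal (u n) = ENNReal.ofReal (v n + (u n - v n)) := by congr 1; ring
    _ ≤ _ := ENNReal.ofReal_add_le

theorem ultraLim_congr {u v : ℕ → ℝ} (h : Tendsto (fun n => u n - v n) atTop (𝓝 0)) :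
    ultraLim u = ultraLim v :=
  le_antisymm (ultraLim_le_of_tendsto_sub h)
    (ultraLim_le_of_tendsto_sub (by simpa using h.neg))

theorem ultraLim_add {u v : ℕ → ℝ} (hu : ∀ n, 0 ≤ u n) (hv : ∀ n, 0 ≤ v n) :
    ultraLim (fun n => u n + v n) = ultraLim u + ultraLim v := by
  refine tendsto_nhds_unique (tendsto_ultraLim _) ?_
  simp only [ENNReal.ofReal_add (hu _) (hv _)]
  exact (tendsto_ultraLim u).add (tendsto_ultraLim v)

theorem ultraLim_const_mul (c : ℝ≥0) (u : ℕ → ℝ) :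
    ultraLim (fun n => c * u n) = c * ultraLim u := by
  refine tendsto_nhds_unique (tendsto_ultraLim _) ?_
  simp only [ENNReal.ofReal_mul c.coe_nonneg, ENNReal.ofReal_coe_nnreal]
  exact ENNReal.Tendsto.const_mul (tendsto_ultraLim u) (.inr ENNReal.coe_ne_top)

theorem ultraLim_eq_of_tendsto {u : ℕ → ℝ} {a : ℝ} (h : Tendsto u atTop (𝓝 a)) :
    ultraLim u = ENNReal.ofReal a :=
  tendsto_nhds_unique (tendsto_ultraLim u)
    (ENNReal.tendsto_ofReal (h.mono_left hyperfilter_le_atTop))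

theorem ultraLim_mono {u v : ℕ → ℝ} (h : ∀ᶠ n in atTop, u n ≤ v n) : ultraLim u ≤ ultraLim v :=
  le_of_tendsto_of_tendsto (tendsto_ultraLim u) (tendsto_ultraLim v)
    ((h.filter_mono hyperfilter_le_atTop).mono fun _ h => ENNReal.ofReal_le_ofReal h)

/-! ### Singular traces from lacunary block systems -/

/-- Dimensions `d n`, levels `κ n` and weights `w n`, where the level `κ n` belongs to the indices
between `d n` and `d (n + 1)`, together with cut-off indices `q n` between `d n` and `d (n + 1)`
and `p n` between `d (n + 1)` and `d (n + 2)` at which a change by a bounded factor is negligible. -/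
structure BlockSystem where
  d : ℕ → ℕ
  q : ℕ → ℕ
  p : ℕ → ℕ
  κ : ℕ → ℝ
  w : ℕ → ℝ
  one_le_d : ∀ n, 1 ≤ d n
  κ_nonneg : ∀ n, 0 ≤ κ n
  w_nonneg : ∀ n, 0 ≤ w n
  normalized : ∀ n, w n * d (n + 1) * κ n = 1
  mul_d_le_q : ∀ m, ∀ᶠ n in atTop, m * d n ≤ q n
  mul_d_le_p : ∀ m, ∀ᶠ n in atTop, m * d (n + 1) ≤ p n
  q_le_p : ∀ n, q n ≤ p n
  tendsto_q : Tendsto (fun n => w n * q n * κ n) atTop (𝓝 0)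
  tendsto_p : Tendsto (fun n => w n * p n * κ (n + 1)) atTop (𝓝 0)

namespace BlockSystem

variable (S : BlockSystem)

/-- Up to a subspace of dimension `O(d n)`, the form of `A` is `O(κ n)`. -/
def Dominates (A : H →L[ℂ] H) : Prop :=
  ∃ (m : ℕ) (C : ℝ), 0 ≤ C ∧ ∀ᶠ n in atTop, ∃ (V : Submodule ℂ H) (_ : FiniteDimensional ℂ V),
    Module.finrank ℂ V ≤ m * S.d n ∧ ∀ v ∈ Vᗮ, A.reApplyInnerSelf v ≤ C * S.κ n * ‖v‖ ^ 2

theorem Dominates.add {A B : H →L[ℂ] H} (hA : S.Dominates A) (hB : S.Dominates B) :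
    S.Dominates (A + B) := by
  obtain ⟨m, C, hC, hA⟩ := hA
  obtain ⟨m', C', hC', hB⟩ := hB
  refine ⟨m + m', C + C', by positivity, ?_⟩
  filter_upwards [hA, hB] with n ⟨V, _, hV, hVA⟩ ⟨W, _, hW, hWB⟩
  refine ⟨V ⊔ W, inferInstance, ?_, fun v hv => ?_⟩
  · rw [add_mul]
    exact (Submodule.finrank_add_le_finrank_add_finrank V W).trans (add_le_add hV hW)
  · rw [reApplyInnerSelf_add]
    have h1 := hVA v (Submodule.orthogonal_le le_sup_left hv)
    have h2 := hWB v (Submodule.orthogonal_le le_sup_right hv)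
    linarith

theorem Dominates.mono {A B : H →L[ℂ] H} (hB : S.Dominates B)
    (h : ∀ v, A.reApplyInnerSelf v ≤ B.reApplyInnerSelf v) : S.Dominates A := by
  obtain ⟨m, C, hC, hB⟩ := hB
  refine ⟨m, C, hC, hB.mono fun n ⟨V, hfin, hV, hVB⟩ => ⟨V, hfin, hV, fun v hv => ?_⟩⟩
  exact (h v).trans (hVB v hv)

theorem Dominates.ofReal_smul {A : H →L[ℂ] H} (hA : S.Dominates A) {c : ℝ} (hc : 0 ≤ c) :
    S.Dominates ((c : ℂ) • A) := by
  obtain ⟨m, C, hC, hA⟩ := hA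
  refine ⟨m, c * C, by positivity, hA.mono fun n ⟨V, hfin, hV, hVA⟩ => ⟨V, hfin, hV, fun v hv => ?_⟩⟩
  rw [reApplyInnerSelf_ofReal_smul, mul_assoc, mul_assoc]
  exact mul_le_mul_of_nonneg_left (by simpa [mul_assoc] using hVA v hv) hc

theorem dominates_ofReal_smul_iff {A : H →L[ℂ] H} {c : ℝ} (hc : 0 < c) :
    S.Dominates ((c : ℂ) • A) ↔ S.Dominates A := by
  refine ⟨fun h => ?_, fun h => h.ofReal_smul S hc.le⟩
  have := h.ofReal_smul S (inv_nonneg.2 hc.le)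
  rwa [smul_smul, ← Complex.ofReal_mul, inv_mul_cancel₀ hc.ne', Complex.ofReal_one, one_smul] at this

theorem dominates_add_iff {A B : H →L[ℂ] H} (hA : 0 ≤ A) (hB : 0 ≤ B) :
    S.Dominates (A + B) ↔ S.Dominates A ∧ S.Dominates B := by
  refine ⟨fun h => ⟨h.mono S fun v => ?_, h.mono S fun v => ?_⟩, fun h => h.1.add S h.2⟩
  · rw [reApplyInnerSelf_add]
    linarith [reApplyInnerSelf_nonneg hB v]
  · rw [reApplyInnerSelf_add]
    linarith [reApplyInnerSelf_nonneg hA v]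

/-- If w ⟂ B(V) then B*w ⟂ V, so ‖B*w‖² ≤ ‖BB*w‖ ‖w‖ ≤ (Cκ_n)^(1/2) ‖B*w‖ ‖w‖, and one factor ‖B*w‖
cancels. -/
theorem Dominates.mul_star_self {B : H →L[ℂ] H} (h : S.Dominates (star B * B)) :
    S.Dominates (B * star B) := by
  obtain ⟨m, C, hC, h⟩ := h
  refine ⟨m, C, hC, h.mono fun n ⟨V, hfin, hV, hVB⟩ =>
    ⟨V.map (B : H →ₗ[ℂ] H), inferInstance, (Submodule.finrank_map_le _ _).trans hV, fun w hw => ?_⟩⟩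
  have hw' : star B w ∈ Vᗮ := fun v hv => by
    rw [ContinuousLinearMap.star_eq_adjoint, ContinuousLinearMap.adjoint_inner_right]
    exact hw _ (Submodule.mem_map_of_mem hv)
  have h1 := hVB _ hw'
  rw [reApplyInnerSelf_star_mul_self] at h1
  rw [reApplyInnerSelf_mul_star_self]
  have h2 : ‖star B w‖ ^ 2 ≤ ‖B (star B w)‖ * ‖w‖ := by
    rw [← reApplyInnerSelf_mul_star_self, ContinuousLinearMap.reApplyInnerSelf_apply]
    exact (RCLike.re_le_norm _).trans (norm_inner_le_norm _ _)
  have h3 : (‖star B w‖ ^ 2) ^ 2 ≤ (C * S.κ n * ‖star B w‖ ^ 2) * ‖w‖ ^ 2 := by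
    calc (‖star B w‖ ^ 2) ^ 2 ≤ (‖B (star B w)‖ * ‖w‖) ^ 2 := by gcongr
      _ = ‖B (star B w)‖ ^ 2 * ‖w‖ ^ 2 := by ring
      _ ≤ _ := by gcongr
  rcases eq_or_lt_of_le (sq_nonneg ‖star B w‖) with h0 | h0
  · rw [← h0]
    have := S.κ_nonneg n
    positivity
  · refine le_of_mul_le_mul_right ?_ h0
    calc _ = (‖star B w‖ ^ 2) ^ 2 := by ring
      _ ≤ _ := h3
      _ = _ := by ring

theorem dominates_star_mul_self_iff (B : H →L[ℂ] H) :
    S.Dominates (star B * B) ↔ S.Dominates (B * star B) :=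
  ⟨Dominates.mul_star_self S, fun h => by
    simpa using Dominates.mul_star_self S (B := star B) (by simpa using h)⟩

/-- The weighted partial traces over the blocks. -/
def blockSum (A : H →L[ℂ] H) (n : ℕ) : ℝ :=
  S.w n * (kyFan A (S.p n) - kyFan A (S.q n))

theorem blockSum_nonneg (A : H →L[ℂ] H) (n : ℕ) : 0 ≤ S.blockSum A n :=
  mul_nonneg (S.w_nonneg n) (sub_nonneg.2 (kyFan_mono A (S.q_le_p n)))

/-- Once q_n absorbs the m d_n exceptional dimensions, each further dimension costs at most Cκ_n. -/
theorem tendsto_kyFan_two_mul_q {A : H →L[ℂ] H} (hA : 0 ≤ A) (h : S.Dominates A) :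
    Tendsto (fun n => S.w n * (kyFan A (2 * S.q n) - kyFan A (S.q n))) atTop (𝓝 0) := by
  obtain ⟨m, C, hC, h⟩ := h
  refine squeeze_zero' (g := fun n => 2 * C * (S.w n * S.q n * S.κ n))
    (.of_forall fun n => mul_nonneg (S.w_nonneg n) (sub_nonneg.2 (kyFan_mono A (by omega)))) ?_
    (by simpa using S.tendsto_q.const_mul (2 * C))
  filter_upwards [h, S.mul_d_le_q m] with n ⟨V, _, hV, hVA⟩ hq
  have h1 := kyFan_le_add_of_le_on_orthogonal hA (hV.trans hq)
    (mul_nonneg hC (S.κ_nonneg n)) hVA (2 * S.q n)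
  push_cast at h1
  calc _ ≤ S.w n * (2 * S.q n * (C * S.κ n)) :=
        mul_le_mul_of_nonneg_left (by linarith) (S.w_nonneg n)
    _ = _ := by ring

theorem tendsto_kyFan_two_mul_p {A : H →L[ℂ] H} (hA : 0 ≤ A) (h : S.Dominates A) :
    Tendsto (fun n => S.w n * (kyFan A (2 * S.p n) - kyFan A (S.p n))) atTop (𝓝 0) := by
  obtain ⟨m, C, hC, h⟩ := h
  refine squeeze_zero' (g := fun n => 2 * C * (S.w n * S.p n * S.κ (n + 1)))
    (.of_forall fun n => mul_nonneg (S.w_nonneg n) (sub_nonneg.2 (kyFan_mono A (by omega)))) ?_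
    (by simpa using S.tendsto_p.const_mul (2 * C))
  filter_upwards [(tendsto_add_atTop_nat 1).eventually h, S.mul_d_le_p m] with n ⟨V, _, hV, hVA⟩ hp
  have h1 := kyFan_le_add_of_le_on_orthogonal hA (hV.trans hp)
    (mul_nonneg hC (S.κ_nonneg (n + 1))) hVA (2 * S.p n)
  push_cast at h1
  calc _ ≤ S.w n * (2 * S.p n * (C * S.κ (n + 1))) :=
        mul_le_mul_of_nonneg_left (by linarith) (S.w_nonneg n)
    _ = _ := by ring

/-- Superadditivity at the doubled index is used at one end of the block and subadditivity at the
other: the lower error sits at p_n, the upper one at q_n. -/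
theorem tendsto_blockSum_add_sub {A B : H →L[ℂ] H} (hA : 0 ≤ A) (hB : 0 ≤ B)
    (h : S.Dominates (A + B)) :
    Tendsto (fun n => S.blockSum (A + B) n - (S.blockSum A n + S.blockSum B n))
      atTop (𝓝 0) := by
  have hAB := add_nonneg hA hB
  refine tendsto_of_tendsto_of_tendsto_of_le_of_le
    (by simpa using (S.tendsto_kyFan_two_mul_p hAB h).neg) (S.tendsto_kyFan_two_mul_q hAB h) ?_ ?_
  · intro n
    have h1 := kyFan_add_kyFan_le hA hB (S.p n) (S.p n)
    have h2 := kyFan_add_le A B (S.q n)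
    rw [← two_mul] at h1
    have := mul_nonneg (S.w_nonneg n) (sub_nonneg.2 (add_le_add h1 h2))
    simp only [blockSum]
    linarith
  · intro n
    have h1 := kyFan_add_kyFan_le hA hB (S.q n) (S.q n)
    have h2 := kyFan_add_le A B (S.p n)
    rw [← two_mul] at h1
    have := mul_nonneg (S.w_nonneg n) (sub_nonneg.2 (add_le_add h1 h2))
    simp only [blockSum]
    linarith

open Classical in
/-- The trace of a block system: the limit of the weighted block sums on dominated operators,
and `∞` elsewhere. -/
def trace (A : H →L[ℂ] H) : ℝ≥0∞ :=
  if S.Dominates A then ultraLim (S.blockSum A) else ∞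

theorem trace_of_dominates {A : H →L[ℂ] H} (h : S.Dominates A) :
    S.trace A = ultraLim (S.blockSum A) :=
  if_pos h

theorem trace_of_not_dominates {A : H →L[ℂ] H} (h : ¬ S.Dominates A) : S.trace A = ∞ :=
  if_neg h

/-- The Ky Fan functionals of A are constant beyond dim V, which q_n eventually exceeds. -/
theorem trace_eq_zero_of_nonpos_on_orthogonal {A : H →L[ℂ] H} (hA : 0 ≤ A) {V : Submodule ℂ H}
    [FiniteDimensional ℂ V] (h : ∀ v ∈ Vᗮ, A.reApplyInnerSelf v ≤ 0) : S.trace A = 0 := by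
  have hdom : S.Dominates A := by
    refine ⟨Module.finrank ℂ V, 0, le_rfl, .of_forall fun n => ⟨V, inferInstance, ?_, ?_⟩⟩
    · exact Nat.le_mul_of_pos_right _ (S.one_le_d n)
    · simpa using h
  rw [S.trace_of_dominates hdom, ← le_zero_iff]
  have h0 : ultraLim (fun _ => 0) = 0 := by
    simpa using ultraLim_eq_of_tendsto (tendsto_const_nhds (x := (0 : ℝ)))
  rw [← h0]
  refine ultraLim_mono ?_
  filter_upwards [S.mul_d_le_q (Module.finrank ℂ V)] with n hn
  have h1 := kyFan_le_add_of_le_on_orthogonal hA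
    ((Nat.le_mul_of_pos_right _ (S.one_le_d n)).trans hn) le_rfl (by simpa using h) (S.p n)
  exact mul_nonpos_of_nonneg_of_nonpos (S.w_nonneg n) (by linarith)

theorem isSingularTrace_trace : IsSingularTrace (S.trace : (H →L[ℂ] H) → ℝ≥0∞) where
  map_add A B hA hB := by
    by_cases h : S.Dominates (A + B)
    · obtain ⟨h1, h2⟩ := (S.dominates_add_iff hA hB).1 h
      rw [S.trace_of_dominates h, S.trace_of_dominates h1, S.trace_of_dominates h2,
        ← ultraLim_add (S.blockSum_nonneg A) (S.blockSum_nonneg B)]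
      exact ultraLim_congr (S.tendsto_blockSum_add_sub hA hB h)
    · rw [S.trace_of_not_dominates h]
      rw [S.dominates_add_iff hA hB, not_and_or] at h
      rcases h with h | h <;> simp [S.trace_of_not_dominates h]
  map_smul c A hA := by
    -- Since 0 · ∞ = 0, the case c = 0 needs the trace of 0 to vanish, whatever A is.
    rcases eq_or_ne c 0 with rfl | hc
    · simpa using S.trace_eq_zero_of_nonpos_on_orthogonal (A := (0 : H →L[ℂ] H)) le_rfl (V := ⊥)
        (by simp [ContinuousLinearMap.reApplyInnerSelf_apply])
    have hc' : (0 : ℝ) < c := NNReal.coe_pos.2 (pos_iff_ne_zero.2 hc)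
    by_cases h : S.Dominates A
    · rw [S.trace_of_dominates h, S.trace_of_dominates ((S.dominates_ofReal_smul_iff hc').2 h),
        ← ultraLim_const_mul]
      congr 1
      funext n
      simp only [blockSum, kyFan_ofReal_smul hc']
      ring
    · rw [S.trace_of_not_dominates h,
        S.trace_of_not_dominates (mt (S.dominates_ofReal_smul_iff hc').1 h),
        ENNReal.mul_top (by simpa using hc)]
  map_star_mul_self B := by
    by_cases h : S.Dominates (star B * B)
    · rw [S.trace_of_dominates h, S.trace_of_dominates ((S.dominates_star_mul_self_iff B).1 h)]
      congr 1
      funext n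
      simp only [blockSum, kyFan_star_mul_self]
    · rw [S.trace_of_not_dominates h,
        S.trace_of_not_dominates (mt (S.dominates_star_mul_self_iff B).2 h)]
  map_finiteRank_projection P hP hfin := by
    refine S.trace_eq_zero_of_nonpos_on_orthogonal hP.nonneg
      (V := LinearMap.range (P : H →ₗ[ℂ] H)) fun v hv => le_of_eq ?_
    have h : inner ℂ v (P v) = 0 := 
      Submodule.inner_left_of_mem_orthogonal (LinearMap.mem_range_self (P : H →ₗ[ℂ] H) v) hv
    rw [ContinuousLinearMap.reApplyInnerSelf_apply, ← inner_conj_symm, h]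
    simp

/-- Up to index m d_{n+1} the increments are at most Cκ_n, in total mC after weighting; from there
to p_n the level κ_{n+1} makes them negligible. -/
theorem trace_ne_top_of_dominates {A : H →L[ℂ] H} (hA : 0 ≤ A) (h : S.Dominates A) :
    S.trace A ≠ ∞ := by
  rw [S.trace_of_dominates h]
  obtain ⟨m, C, hC, h⟩ := h
  have hlim : Tendsto (fun n => m * C + C * (S.w n * S.p n * S.κ (n + 1))) atTop
      (𝓝 (m * C + C * 0)) := (S.tendsto_p.const_mul C).const_add _
  refine ne_top_of_le_ne_top ?_ ((ultraLim_mono (u := S.blockSum A) ?_).trans_eq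
    (ultraLim_eq_of_tendsto hlim))
  · exact ENNReal.ofReal_ne_top
  filter_upwards [h, (tendsto_add_atTop_nat 1).eventually h, S.mul_d_le_q m]
    with n ⟨V, _, hV, hVA⟩ ⟨W, _, hW, hWA⟩ hq
  have h1 := kyFan_le_add_of_le_on_orthogonal hA (hV.trans hq)
    (mul_nonneg hC (S.κ_nonneg n)) hVA (m * S.d (n + 1))
  have h2 := kyFan_le_add_of_le_on_orthogonal hA hW
    (mul_nonneg hC (S.κ_nonneg (n + 1))) hWA (S.p n)
  push_cast at h1
  calc S.blockSum A n
      ≤ S.w n * (m * S.d (n + 1) * (C * S.κ n) + S.p n * (C * S.κ (n + 1))) :=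
        mul_le_mul_of_nonneg_left (by linarith) (S.w_nonneg n)
    _ = m * C * (S.w n * S.d (n + 1) * S.κ n) + C * (S.w n * S.p n * S.κ (n + 1)) := by ring
    _ = _ := by rw [S.normalized, mul_one]

theorem trace_ne_zero_of_le_on_subspace {A : H →L[ℂ] H} (hA : 0 ≤ A) {c : ℝ} (hc : 0 < c)
    (h : ∀ᶠ n in atTop, ∃ W : Submodule ℂ H, (S.d (n + 1) : Cardinal) ≤ Module.rank ℂ W ∧
      ∀ v ∈ W, c * S.κ n * ‖v‖ ^ 2 ≤ A.reApplyInnerSelf v) : S.trace A ≠ 0 := by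
  by_cases hdom : S.Dominates A
  swap
  · simp [S.trace_of_not_dominates hdom]
  rw [S.trace_of_dominates hdom]
  have hlim : Tendsto (fun n => c - c * (S.w n * S.q n * S.κ n)) atTop
      (𝓝 (c - c * 0)) := (S.tendsto_q.const_mul c).const_sub _
  refine ne_of_gt (lt_of_lt_of_le ?_ ((ultraLim_eq_of_tendsto hlim).symm.trans_le
    (ultraLim_mono (v := S.blockSum A) ?_)))
  · simpa using hc
  filter_upwards [h, S.mul_d_le_p 1] with n ⟨W, hW, hWA⟩ hp
  have h3 := S.normalized n
  have h4 : kyFan A (S.q n) + ((S.d (n + 1) : ℝ) - S.q n) * (c * S.κ n) ≤ kyFan A (S.p n) := by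
    have hcκ := mul_nonneg hc.le (S.κ_nonneg n)
    -- A block system does not force q_n ≤ d_{n+1}; when this fails the bound is trivial.
    rcases le_total (S.q n) (S.d (n + 1)) with hq | hq
    · exact (kyFan_add_le_of_le_on_subspace hA hq hW hcκ hWA).trans
        (kyFan_mono A (by simpa using hp))
    · have h5 : ((S.d (n + 1) : ℝ) - S.q n) * (c * S.κ n) ≤ 0 :=
        mul_nonpos_of_nonpos_of_nonneg (sub_nonpos.2 (by exact_mod_cast hq)) hcκ
      linarith [kyFan_mono A (S.q_le_p n)]
  calc c - c * (S.w n * S.q n * S.κ n)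
      = c * (S.w n * S.d (n + 1) * S.κ n) - c * (S.w n * S.q n * S.κ n) := by rw [h3, mul_one]
    _ = S.w n * (((S.d (n + 1) : ℝ) - S.q n) * (c * S.κ n)) := by ring
    _ ≤ _ := mul_le_mul_of_nonneg_left (by linarith) (S.w_nonneg n)

end BlockSystem

/-! ### Lacunary sequences -/

/-- Take k = ⌊r^(-1/2)⌋, so that k r ≤ r^(1/2). -/
theorem exists_tendsto_atTop_mul_tendsto_zero {r : ℕ → ℝ} (hr0 : ∀ n, 0 < r n)
    (hr1 : ∀ n, r n ≤ 1) (hr : Tendsto r atTop (𝓝 0)) :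
    ∃ k : ℕ → ℕ, (∀ n, 1 ≤ k n) ∧ (∀ n, k n * r n ≤ 1) ∧ Tendsto k atTop atTop ∧
      Tendsto (fun n => k n * r n) atTop (𝓝 0) := by
  have hs0 : ∀ n, 0 < √(r n) := fun n => Real.sqrt_pos.2 (hr0 n)
  have hs : Tendsto (fun n => √(r n)) atTop (𝓝 0) := by
    simpa [Function.comp_def] using (Real.continuous_sqrt.tendsto 0).comp hr
  have hle : ∀ n, (⌊(√(r n))⁻¹⌋₊ : ℝ) * r n ≤ √(r n) := fun n =>
    calc (⌊(√(r n))⁻¹⌋₊ : ℝ) * r n ≤ (√(r n))⁻¹ * r n :=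
          mul_le_mul_of_nonneg_right (Nat.floor_le (inv_nonneg.2 (hs0 n).le)) (hr0 n).le
      _ = (√(r n))⁻¹ * (√(r n) * √(r n)) := by rw [Real.mul_self_sqrt (hr0 n).le]
      _ = √(r n) := by rw [inv_mul_cancel_left₀ (hs0 n).ne']
  have hs1 : ∀ n, √(r n) ≤ 1 := fun n => Real.sqrt_le_one.2 (hr1 n)
  refine ⟨fun n => ⌊(√(r n))⁻¹⌋₊, fun n => ?_, fun n => (hle n).trans (hs1 n), ?_, ?_⟩
  · exact Nat.le_floor (by simpa using (one_le_inv₀ (hs0 n)).2 (hs1 n))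
  · exact tendsto_nat_floor_atTop.comp (tendsto_inv_nhdsGT_zero.comp
      (tendsto_nhdsWithin_iff.2 ⟨hs, .of_forall hs0⟩))
  · exact squeeze_zero (fun n => mul_nonneg (Nat.cast_nonneg _) (hr0 n).le) hle hs

section Lacunary

variable {x : ℕ → ℕ} (hx1 : ∀ n, 1 ≤ x n) (hx : Monotone x)
  (hlim : Tendsto (fun n : ℕ => (x n : ℝ) / (x (n + 1) : ℝ)) atTop (𝓝 0))

include hx1 in
theorem cast_pos_of_one_le (n : ℕ) : (0 : ℝ) < x n := by exact_mod_cast hx1 n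

include hx1 in
theorem ratio_pos (n : ℕ) : 0 < (x n : ℝ) / (x (n + 1) : ℝ) :=
  div_pos (cast_pos_of_one_le hx1 n) (cast_pos_of_one_le hx1 _)

include hx1 hx in
theorem ratio_le_one (n : ℕ) : (x n : ℝ) / (x (n + 1) : ℝ) ≤ 1 :=
  (div_le_one (cast_pos_of_one_le hx1 _)).2 (by exact_mod_cast hx (Nat.le_succ n))

include hx1 hlim in
theorem tendsto_inv_ratio :
    Tendsto (fun n : ℕ => (x (n + 1) : ℝ) / (x n : ℝ)) atTop atTop := by
  have := tendsto_inv_nhdsGT_zero.comp (tendsto_nhdsWithin_iff.2 ⟨hlim, .of_forall (ratio_pos hx1)⟩)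
  simpa [Function.comp_def] using this

include hx1 hlim in
theorem tendsto_cast_atTop_of_ratio : Tendsto (fun n => (x n : ℝ)) atTop atTop := by
  rw [← tendsto_add_atTop_iff_nat 1]
  refine tendsto_atTop_mono (fun n => ?_) (tendsto_inv_ratio hx1 hlim)
  exact div_le_self (Nat.cast_nonneg _) (by exact_mod_cast hx1 n)

include hx1 hlim in
theorem eventually_lt_succ : ∀ᶠ n in atTop, x n < x (n + 1) := by
  filter_upwards [hlim.eventually (gt_mem_nhds zero_lt_one)] with n hn
  rw [div_lt_one (cast_pos_of_one_le hx1 _)] at hn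
  exact_mod_cast hn

include hx1 hx hlim in
-- The factor in q_n is controlled by x_n / x_{n+1}. That in p_n is controlled by the α-th power of
-- the next ratio, since w_n x_{n+1} κ_{n+1} = (x_{n+1} / x_{n+2})^α.
theorem exists_blockSystem {α : ℝ} (hα : 0 < α) :
    ∃ S : BlockSystem, S.d = x ∧ S.κ = fun n => (x (n + 1) : ℝ) ^ (-α) := by
  have hpos := cast_pos_of_one_le hx1
  obtain ⟨k, -, hk2, hk3, hk4⟩ := exists_tendsto_atTop_mul_tendsto_zero (ratio_pos hx1)
    (ratio_le_one hx1 hx) hlim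
  obtain ⟨l, hl1, -, hl3, hl4⟩ := exists_tendsto_atTop_mul_tendsto_zero
    (r := fun n => ((x n : ℝ) / (x (n + 1) : ℝ)) ^ α)
    (fun n => Real.rpow_pos_of_pos (ratio_pos hx1 n) α)
    (fun n => Real.rpow_le_one (ratio_pos hx1 n).le (ratio_le_one hx1 hx n) hα.le)
    (by simpa [Real.zero_rpow hα.ne'] using hlim.rpow_const (.inr hα.le))
  have hw : ∀ n, (x (n + 1) : ℝ) ^ (α - 1) * (x (n + 1) : ℝ) ^ (-α) = (x (n + 1) : ℝ)⁻¹ := by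
    intro n
    rw [← Real.rpow_add (hpos _), ← Real.rpow_neg_one]
    congr 1; ring
  refine ⟨{ d := x
            q := fun n => k n * x n
            p := fun n => l (n + 1) * x (n + 1)
            κ := fun n => (x (n + 1) : ℝ) ^ (-α)
            w := fun n => (x (n + 1) : ℝ) ^ (α - 1)
            one_le_d := hx1
            κ_nonneg := fun n => Real.rpow_nonneg (Nat.cast_nonneg _) _
            w_nonneg := fun n => Real.rpow_nonneg (Nat.cast_nonneg _) _
            normalized := fun n => ?_
            mul_d_le_q := fun m => ?_
            mul_d_le_p := fun m => ?_
            q_le_p := fun n => ?_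
            tendsto_q := ?_
            tendsto_p := ?_ }, rfl, rfl⟩
  · rw [mul_right_comm, hw, inv_mul_cancel₀ (hpos _).ne']
  · filter_upwards [hk3.eventually_ge_atTop m] with n hn
    exact Nat.mul_le_mul_right _ hn
  · filter_upwards [(tendsto_add_atTop_nat 1).eventually (hl3.eventually_ge_atTop m)] with n hn
    exact Nat.mul_le_mul_right _ hn
  · refine le_trans ?_ (Nat.le_mul_of_pos_left _ (hl1 (n + 1)))
    have := hk2 n
    rw [← mul_div_assoc, div_le_one (hpos _)] at this
    exact_mod_cast this
  · refine hk4.congr fun n => ?_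
    push_cast
    calc (k n : ℝ) * (x n / x (n + 1)) = k n * x n * (x (n + 1) : ℝ)⁻¹ := by ring
      _ = _ := by rw [← hw]; ring
  · refine ((tendsto_add_atTop_iff_nat 1).2 hl4).congr fun n => ?_
    have hx' : (x (n + 1) : ℝ) ^ (α - 1) * x (n + 1) = (x (n + 1) : ℝ) ^ α := by
      rw [← Real.rpow_add_one (hpos _).ne', sub_add_cancel]
    push_cast
    rw [Real.div_rpow (Nat.cast_nonneg _) (Nat.cast_nonneg _), Real.rpow_neg (Nat.cast_nonneg _),
      ← hx']
    ring

/-! ### Operators with lacunary singular values -/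

theorem rank_eigenspanAbove_lt {T : H →L[ℂ] H} {k : ℕ} {s : ℝ} (h0 : 0 < mu T k)
    (hs : mu T k < s) : Module.rank ℂ (eigenspanAbove T s) < (k : Cardinal) := by
  -- An empty set would have infimum 0, against `h0`.
  have hne : {s : ℝ | 0 ≤ s ∧ Module.rank ℂ (eigenspanAbove T s) < (k : Cardinal)}.Nonempty := by
    by_contra hne
    rw [Set.not_nonempty_iff_eq_empty] at hne
    simp [mu, hne] at h0
  obtain ⟨r, ⟨-, hr⟩, hrs⟩ := exists_lt_of_csInf_lt hne hs
  refine lt_of_le_of_lt (Submodule.rank_mono ?_) hr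
  exact iSup₂_le fun l hl => le_iSup₂_of_le (f := fun l (_ : r < l) => Module.End.eigenspace
    ((CFC.abs T : H →L[ℂ] H) : H →ₗ[ℂ] H) (l : ℂ)) l (hrs.trans hl) le_rfl

theorem le_rank_eigenspanAbove {T : H →L[ℂ] H} {k : ℕ} {s : ℝ} (h0 : 0 ≤ s) (hs : s < mu T k) :
    (k : Cardinal) ≤ Module.rank ℂ (eigenspanAbove T s) := by
  by_contra! h
  exact hs.not_ge (csInf_le ⟨0, fun _ h => h.1⟩ ⟨h0, h⟩)

variable {T : H →L[ℂ] H}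
  (hμ : ∀ n k : ℕ, x n < k → k ≤ x (n + 1) → mu T k = 1 / (x (n + 1) : ℝ))

include hx1 hx hlim hμ in
theorem singularlyTraceable_abs_rpow (hT : IsCompactOperator T) {α : ℝ} (hα : 0 < α) :
    SingularlyTraceable (CFC.abs T ^ α) := by
  have hpos := cast_pos_of_one_le hx1
  have hnonneg : (0 : H →L[ℂ] H) ≤ CFC.abs T ^ α := CFC.rpow_nonneg
  obtain ⟨S, hd, hκ⟩ := exists_blockSystem hx1 hx hlim hα
  refine ⟨isCompactOperator_rpow (CFC.abs_nonneg T) (isCompactOperator_abs hT) hα, S.trace,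
    S.isSingularTrace_trace, ?_⟩
  rw [CFC.abs_of_nonneg _ hnonneg]
  have hκ' : ∀ (c : ℝ) n, 0 ≤ c → (c / x (n + 1)) ^ α = c ^ α * S.κ n := fun c n hc => by
    rw [hκ, Real.div_rpow hc (Nat.cast_nonneg _), div_eq_mul_inv,
      ← Real.rpow_neg (Nat.cast_nonneg _)]
  -- As an infimum, `mu` controls ranks only strictly above or below its value; the factors 1/2 and
  -- 2 provide this room at the cost of constants.
  refine ⟨S.trace_ne_zero_of_le_on_subspace hnonneg (c := (1 / 2) ^ α) (by positivity) ?_,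
    S.trace_ne_top_of_dominates hnonneg ⟨1, 2 ^ α, by positivity, ?_⟩⟩
  · filter_upwards [eventually_lt_succ hx1 hlim] with n hn
    have h := hμ n (x (n + 1)) hn le_rfl
    refine ⟨eigenspanAbove T (1 / 2 / x (n + 1)), ?_, fun v hv => ?_⟩
    · rw [hd]
      refine le_rank_eigenspanAbove (div_nonneg (by norm_num) (hpos _).le) ?_
      rw [h]
      exact div_lt_div_of_pos_right (by norm_num) (hpos _)
    · rw [← hκ' _ _ (by norm_num)]
      exact rpow_mul_norm_sq_le_of_mem_eigenspanAbove T hα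
        (div_nonneg (by norm_num) (hpos _).le) hv
  · filter_upwards [eventually_lt_succ hx1 hlim] with n hn
    -- The first index of the block bounds the number of larger eigenvalues by x_n; the last index
    -- served for the lower bound.
    have h := hμ n (x n + 1) (Nat.lt_succ_self _) hn
    have hr : Module.rank ℂ (eigenspanAbove T (2 / x (n + 1))) < ((x n + 1 : ℕ) : Cardinal) := by
      refine rank_eigenspanAbove_lt ?_ ?_ <;> rw [h]
      · exact div_pos one_pos (hpos _)
      · exact div_lt_div_of_pos_right (by norm_num) (hpos _)
    have hfin : FiniteDimensional ℂ (eigenspanAbove T (2 / x (n + 1))) :=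
      Module.rank_lt_aleph0_iff.1 (hr.trans Cardinal.natCast_lt_aleph0)
    refine ⟨eigenspanAbove T (2 / x (n + 1)), hfin, ?_, fun v hv => ?_⟩
    · rw [← Module.finrank_eq_rank, Nat.cast_lt] at hr
      rw [hd, one_mul]
      exact Nat.lt_succ_iff.1 hr
    · rw [← hκ' _ _ (by norm_num)]
      exact le_rpow_mul_norm_sq_of_mem_orthogonal_eigenspanAbove hT hα hv

/-! ### The indices -/

include hx1 hlim in
theorem exists_mem_block (hx0 : x 0 = 1) {y : ℕ} (hy : 2 ≤ y) :
    ∃ n, x n < y ∧ y ≤ x (n + 1) := by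
  have hex : ∃ n, y ≤ x n := by
    obtain ⟨n, hn⟩ := ((tendsto_cast_atTop_of_ratio hx1 hlim).eventually_ge_atTop (y : ℝ)).exists
    exact ⟨n, by exact_mod_cast hn⟩
  classical
  have hspec := Nat.find_spec hex
  have hmin := fun m => Nat.find_min (m := m) hex
  rcases hn : Nat.find hex with _ | n
  · rw [hn, hx0] at hspec; omega
  · rw [hn] at hspec
    exact ⟨n, not_le.1 (hmin n (by omega)), hspec⟩

include hμ in
theorem decayFn_eq_log {n : ℕ} {t : ℝ} (h1 : x n < ⌊Real.exp t⌋₊) (h2 : ⌊Real.exp t⌋₊ ≤ x (n + 1)) :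
    decayFn T t = Real.log (x (n + 1)) := by
  rw [decayFn, hμ n _ h1 h2, one_div, Real.log_inv, neg_neg]

include hx1 hx hlim hμ in
theorem log_le_decayFn (hx0 : x 0 = 1) {n : ℕ} {t : ℝ} (h : x n < ⌊Real.exp t⌋₊) :
    Real.log (x (n + 1)) ≤ decayFn T t := by
  obtain ⟨m, h1, h2⟩ := exists_mem_block hx1 hlim hx0 (y := ⌊Real.exp t⌋₊)
    (by have := hx1 n; omega)
  rw [decayFn_eq_log hμ h1 h2]
  have hnm : n ≤ m := by
    by_contra! hlt
    have := hx (Nat.succ_le_of_lt hlt)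
    rw [Nat.succ_eq_add_one] at this
    omega
  refine Real.log_le_log (cast_pos_of_one_le hx1 _) ?_
  exact_mod_cast hx (Nat.succ_le_succ hnm)

include hx1 hx hlim hμ in
theorem decayFn_le_decayFn (hx0 : x 0 = 1) {s t : ℝ} (hs : 2 ≤ ⌊Real.exp s⌋₊) (hst : s ≤ t) :
    decayFn T s ≤ decayFn T t := by
  obtain ⟨n, h1, h2⟩ := exists_mem_block hx1 hlim hx0 hs
  rw [decayFn_eq_log hμ h1 h2]
  exact log_le_decayFn hx1 hx hlim hμ hx0
    (h1.trans_le (Nat.floor_le_floor (Real.exp_le_exp.2 hst)))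

include hx1 hlim in
theorem tendsto_log_succ : Tendsto (fun n => Real.log (x (n + 1))) atTop atTop :=
  Real.tendsto_log_atTop.comp
    ((tendsto_add_atTop_iff_nat 1).2 (tendsto_cast_atTop_of_ratio hx1 hlim))

include hx1 hx hlim hμ in
theorem hasLowerIndex_zero (hx0 : x 0 = 1) : HasLowerIndex T 0 := by
  have hpos := cast_pos_of_one_le hx1
  refine ⟨∞, ?_, ENNReal.inv_top.symm⟩
  rw [EReal.coe_ennreal_top]
  refine tendsto_const_nhds.congr' ?_
  filter_upwards [eventually_gt_atTop 0] with h hh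
  symm
  rw [EReal.eq_top_iff_forall_lt]
  intro M
  refine lt_of_lt_of_le (EReal.coe_lt_coe_iff.2 (lt_add_one M)) (le_limsup_of_frequently_le ?_)
  refine (tendsto_log_succ hx1 hlim).frequently (Eventually.frequently ?_)
  have hexp : 0 < Real.exp h - 1 := sub_pos.2 (Real.one_lt_exp_iff.2 hh)
  have hratio := (tendsto_add_atTop_iff_nat 1).2
    (Real.tendsto_log_atTop.comp (tendsto_inv_ratio hx1 hlim))
  -- At t = log x_{n+1}, the end of a block, the bound 1 / (e^h - 1) ensures e^(t+h) ≥ x_{n+1} + 1,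
  -- so the window crosses the next jump.
  filter_upwards [eventually_lt_succ hx1 hlim,
    ((tendsto_add_atTop_iff_nat 1).2
      (tendsto_cast_atTop_of_ratio hx1 hlim)).eventually_ge_atTop (1 / (Real.exp h - 1)),
    hratio.eventually_ge_atTop ((M + 1) * h)] with n hn hbig hr
  have hfl : ⌊Real.exp (Real.log (x (n + 1)))⌋₊ = x (n + 1) := by
    rw [Real.exp_log (hpos _), Nat.floor_natCast]
  have h1 : decayFn T (Real.log (x (n + 1))) = Real.log (x (n + 1)) :=
    decayFn_eq_log hμ (n := n) (by rwa [hfl]) hfl.le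
  have h2 : Real.log (x (n + 1 + 1)) ≤ decayFn T (Real.log (x (n + 1)) + h) := by
    refine log_le_decayFn hx1 hx hlim hμ hx0 (Nat.succ_le_iff.1 (Nat.le_floor ?_))
    rw [Real.exp_add, Real.exp_log (hpos _)]
    rw [div_le_iff₀ hexp] at hbig
    push_cast
    linarith
  have h3 : Real.log ((x (n + 1 + 1) : ℝ) / x (n + 1)) =
      Real.log (x (n + 1 + 1)) - Real.log (x (n + 1)) := Real.log_div (hpos _).ne' (hpos _).ne'
  have hr' : (M + 1) * h ≤ Real.log ((x (n + 1 + 1) : ℝ) / x (n + 1)) := hr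
  rw [EReal.coe_le_coe_iff, le_div_iff₀ hh]
  linarith

include hx1 hx hlim hμ in
theorem hasUpperIndex_top (hx0 : x 0 = 1) : HasUpperIndex T ∞ := by
  have hpos := cast_pos_of_one_le hx1
  refine ⟨0, ?_, ENNReal.inv_zero.symm⟩
  rw [EReal.coe_ennreal_zero]
  refine tendsto_const_nhds.congr' ?_
  filter_upwards [eventually_gt_atTop 0] with h hh
  symm
  refine le_antisymm (liminf_le_of_frequently_le ?_) (le_liminf_of_le (by isBoundedDefault) ?_)
  · have ht : Tendsto (fun n => Real.log (x (n + 1)) - h) atTop atTop :=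
      tendsto_atTop_add_const_right _ _ (tendsto_log_succ hx1 hlim)
    refine ht.frequently (Eventually.frequently ?_)
    -- With t = log x_{n+1} - h, the factor 2e^h gives e^t ≥ 2x_n ≥ x_n + 1, so the whole window
    -- stays in one block.
    filter_upwards [eventually_lt_succ hx1 hlim,
      (tendsto_inv_ratio hx1 hlim).eventually_ge_atTop (2 * Real.exp h)] with n hn hr
    have hfl : ⌊Real.exp (Real.log (x (n + 1)))⌋₊ = x (n + 1) := by
      rw [Real.exp_log (hpos _), Nat.floor_natCast]
    have h1 : decayFn T (Real.log (x (n + 1))) = Real.log (x (n + 1)) :=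
      decayFn_eq_log hμ (n := n) (by rwa [hfl]) hfl.le
    have h2 : decayFn T (Real.log (x (n + 1)) - h) = Real.log (x (n + 1)) := by
      refine decayFn_eq_log hμ (n := n) (Nat.succ_le_iff.1 (Nat.le_floor ?_)) ?_
      · rw [Real.exp_sub, Real.exp_log (hpos _), le_div_iff₀ (Real.exp_pos h)]
        rw [le_div_iff₀ (hpos _)] at hr
        have h3 : (1 : ℝ) ≤ x n := by exact_mod_cast hx1 n
        have h4 : Real.exp h ≤ x n * Real.exp h := le_mul_of_one_le_left (Real.exp_pos h).le h3
        push_cast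
        linarith
      · exact (Nat.floor_le_floor (Real.exp_le_exp.2 (by linarith))).trans hfl.le
    rw [sub_add_cancel, h1, h2, sub_self, zero_div, EReal.coe_zero]
  -- Monotonicity is available only from index 2 on, since `mu T 1` is not prescribed.
  · filter_upwards [eventually_ge_atTop (Real.log 2)] with t ht
    rw [← EReal.coe_zero, EReal.coe_le_coe_iff]
    refine div_nonneg (sub_nonneg.2 (decayFn_le_decayFn hx1 hx hlim hμ hx0 ?_ (by linarith))) hh.le
    refine Nat.le_floor ?_
    rw [Nat.cast_ofNat, ← Real.exp_log (zero_lt_two (α := ℝ))]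
    exact Real.exp_le_exp.2 ht

end Lacunary

end SingTrace

end

theorem theorem3p5 {H : Type*} [NormedAddCommGroup H] [InnerProductSpace ℂ H] [CompleteSpace H]
    (x : ℕ → ℕ) (hx0 : x 0 = 1) (hx : Monotone x)
    (hlim : Tendsto (fun n : ℕ => (x n : ℝ) / (x (n + 1) : ℝ)) atTop (𝓝 0))
    (T : H →L[ℂ] H) (hT : IsCompactOperator T)
    (hμ : ∀ n k : ℕ, x n < k → k ≤ x (n + 1) → SingTrace.mu T k = 1 / (x (n + 1) : ℝ)) :
    (∀ α : ℝ, 0 < α → SingTrace.SingularlyTraceable (CFC.abs T ^ α)) ∧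
      SingTrace.HasLowerIndex T 0 ∧ SingTrace.HasUpperIndex T ∞ := by
  have hx1 : ∀ n, 1 ≤ x n := fun n => hx0.symm.le.trans (hx (Nat.zero_le n))
  exact ⟨fun α hα => SingTrace.singularlyTraceable_abs_rpow hx1 hx hlim hμ hT hα,
    SingTrace.hasLowerIndex_zero hx1 hx hlim hμ hx0,
    SingTrace.hasUpperIndex_top hx1 hx hlim hμ hx0⟩
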